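/- Let $0<\varphi\le\frac{\pi}{2}$, $c=\cos\varphi$, $s=\sin\varphi$. A cubic $\mathcal G^0$ interpolant of the unit circular arc $\{(\cos t,\sin t):|t|\le\varphi\}$ is a polynomial curve $p=(x,y)\colon[-1,1]\to\mathbb R^2$ whose components have degree at most $3$ and which satisfies $p(-1)=(c,-s)$ and $p(1)=(c,s)$. Its simplified radial error is $e(p)=\max_{t\in[-1,1]}|x(t)^2+y(t)^2-1|$. For $\xi,\eta\in\mathbb R$ let $p_{\xi,\eta}$ be the symmetric cubic $\mathcal G^0$ interpolant with Bernstein–Bézier control points $(c,-s),(\xi,-\eta),(\xi,\eta),(c,s)$ on $[-1,1]$. Theorem. The cubic polynomial $$f(x)=243x^3-27c(11-16\sqrt3)x^2-3\bigl(32(1+2\sqrt3)-3(81-32\sqrt3)c^2\bigr)x-32(13+2\sqrt3)c-(163-112\sqrt3)c^3$$ has exactly one zero $\xi$ in the open interval $\bigl(c,\tfrac{4+c}{3}\bigr)$. Put $$\eta=\frac1s\left(\frac{2+\sqrt3}{8}(3\xi+c)^2-\xi c-3-2\sqrt3\right).$$ Then: 1. $(\xi,\eta)$ is the unique pair of parameters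 giving the best symmetric cubic $\mathcal G^0$ interpolant: $e(p_{\xi,\eta})<e(p_{\xi',\eta'})$ for every $(\xi',\eta')\in\mathbb R^2$ with $(\xi',\eta')\neq(\xi,\eta)$, where for $\varphi=\frac\pi2$ only pairs with $\xi'\ge 0$ are considered. 2. $p_{\xi,\eta}$ is a best interpolant among all cubic $\mathcal G^0$ interpolants $p$, symmetric or not: $e(p_{\xi,\eta})\le e(p)$. It is the only best one, except that for $\varphi=\frac\pi2$ its reflection $p_{-\xi,\eta}$ over the $y$-axis is also best (and there is no other). -/

import Mathlib

open Polynomial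

noncomputable section

/-- A parametric polynomial curve `t ↦ (x(t), y(t))` in the plane. -/
abbrev PolyCurve : Type := ℝ[X] × ℝ[X]

/-- The Bernstein polynomial `B_j^n(t) = binom(n,j) ((1+t)/2)^j ((1-t)/2)^(n-j)` over `[-1,1]`. -/
def bernsteinSym (n j : ℕ) : ℝ[X] :=
  C (n.choose j : ℝ) * (C (1 / 2 : ℝ) * (1 + X)) ^ j * (C (1 / 2 : ℝ) * (1 - X)) ^ (n - j)

/-- The Bezier curve of degree at most `n` on `[-1,1]` with control points `b_0, ..., b_n`. -/
def bezierCurve {n : ℕ} (b : Fin (n + 1) → ℝ × ℝ) : PolyCurve :=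
  (∑ j, C (b j).1 * bernsteinSym n j, ∑ j, C (b j).2 * bernsteinSym n j)

/-- The simplified signed radial error function `ψ(t) = x(t)^2 + y(t)^2 - 1`. -/
def signedError (p : PolyCurve) (t : ℝ) : ℝ :=
  p.1.eval t ^ 2 + p.2.eval t ^ 2 - 1

/-- The simplified radial error `max |ψ(t)|` over `t ∈ [-1,1]` (the supremum of a continuous
function over a compact interval, hence a maximum). -/
def simplifiedRadialError (p : PolyCurve) : ℝ :=
  sSup ((fun t : ℝ => |signedError p t|) '' Set.Icc (-1) 1)

/-- `p` has degree at most `n` and interpolates, at `t = -1` and `t = 1`, the two boundary points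
of the arc `t ↦ (cos t, sin t)`, `t ∈ [-φ, φ]`. -/
def IsG0Interpolant (φ : ℝ) (n : ℕ) (p : PolyCurve) : Prop :=
  p.1.natDegree ≤ n ∧ p.2.natDegree ≤ n ∧
  p.1.eval (-1) = Real.cos φ ∧ p.2.eval (-1) = -Real.sin φ ∧
  p.1.eval 1 = Real.cos φ ∧ p.2.eval 1 = Real.sin φ

/-- `p` minimizes the simplified radial error among all interpolants of degree at most `n`. -/
def IsBestG0Interpolant (φ : ℝ) (n : ℕ) (p : PolyCurve) : Prop :=
  IsG0Interpolant φ n p ∧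
    ∀ q : PolyCurve, IsG0Interpolant φ n q → simplifiedRadialError p ≤ simplifiedRadialError q

/-- The cubic interpolant, symmetric over the `x`-axis, with control points
`(cos φ, -sin φ)`, `(ξ, -η)`, `(ξ, η)`, `(cos φ, sin φ)`. -/
def symmetricCubic (φ ξ η : ℝ) : PolyCurve :=
  bezierCurve (n := 3)
    ![(Real.cos φ, -Real.sin φ), (ξ, -η), (ξ, η), (Real.cos φ, Real.sin φ)]

/-- The explicit cubic polynomial in `ξ` whose zero gives the best interpolant. -/
def cubicF (φ ξ : ℝ) : ℝ :=
  243 * ξ ^ 3 - 27 * Real.cos φ * (11 - 16 * √3) * ξ ^ 2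
    - 3 * (32 * (1 + 2 * √3) - 3 * (81 - 32 * √3) * Real.cos φ ^ 2) * ξ
    - 32 * (13 + 2 * √3) * Real.cos φ - (163 - 112 * √3) * Real.cos φ ^ 3

/-- The explicit formula for the second parameter `η` in terms of `ξ`. -/
def cubicEta (φ ξ : ℝ) : ℝ :=
  1 / Real.sin φ *
    ((2 + √3) / 8 * (3 * ξ + Real.cos φ) ^ 2 - ξ * Real.cos φ - 3 - 2 * √3)

end

open Polynomial

noncomputable section

/-! Every cubic interpolant has the form in `cubicError`, and with `v = 1 - t²` the even part of its
error is `v` times a quadratic in `v`. The optimum has `a₂ = b₂ = 0` and error `ε T₃(w)`, `w = √3/2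
- (1 + √3/2) v`, which takes the values `-ε, ε, -ε` at `v = 1, √3 - 1, 3√3 - 5`. If a competitor has
error at most `ε`, its even part minus the optimal one is `v (A + B v + D v²)`, with alternating
signs at these nodes, so `A ≥ 0`, `B ≤ 0`, `D ≥ 0` (`signs_of_alternating`). Written in the
parameters, these inequalities force equality, up to reflection when `c = 0`
(`eq_of_abs_cubicError_le`). This gives optimality and uniqueness together. Existence of the optimum
reduces to one equation in `a`, which is `cubicF` up to a positive factor (`cubicF_root`). -/

/-- The squared distance to the unit circle's centre, minus one, along the cubic curve
`x = c + (1 - t²)(a + a₂ t)`, `y = s t + (1 - t²)(b t + b₂)`. -/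
def cubicError (c s a a₂ b b₂ t : ℝ) : ℝ :=
  (c + (1 - t ^ 2) * (a + a₂ * t)) ^ 2 + (s * t + (1 - t ^ 2) * (b * t + b₂)) ^ 2 - 1

/-- The parameters `(a, b)` give an error function proportional to the Chebyshev polynomial `T₆`,
rescaled so that its outermost zeros lie at `±1`. -/
structure IsEquioscillating (c s a b ε : ℝ) : Prop where
  c_nonneg : 0 ≤ c
  s_pos : 0 < s
  sq_add_sq : c ^ 2 + s ^ 2 = 1
  a_pos : 0 < a
  b_pos : 0 < b
  b_lt : b < s
  coeff_zero : 2 * a * c + 2 * s * b - s ^ 2 = -6 * (1 + √3 / 2) * ε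
  coeff_one : a ^ 2 + b ^ 2 - 2 * s * b = 6 * √3 * (1 + √3 / 2) ^ 2 * ε
  coeff_two : b ^ 2 = 4 * (1 + √3 / 2) ^ 3 * ε

theorem sqrt_three_sq : √3 ^ 2 = 3 := Real.sq_sqrt (by norm_num)

theorem sqrt_three_bounds : 1.73 < √3 ∧ √3 < 1.7321 := by
  constructor
  · exact Real.lt_sqrt_of_sq_lt (by norm_num)
  · rw [Real.sqrt_lt' (by norm_num)]; norm_num

/-! ### Comparison with the equioscillating error -/

/-- Bounds for the even and odd parts of the error as functions of `v = 1 - t²`. -/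
theorem abs_even_add_abs_odd_le {c s a a₂ b b₂ ε : ℝ} (hcs : c ^ 2 + s ^ 2 = 1)
    (hE : ∀ t ∈ Set.Icc (-1 : ℝ) 1, |cubicError c s a a₂ b b₂ t| ≤ ε)
    {v : ℝ} (hv : v ∈ Set.Icc (0 : ℝ) 1) :
    |v * ((2 * a * c + 2 * s * b - s ^ 2)
        + (a ^ 2 + b₂ ^ 2 + a₂ ^ 2 + b ^ 2 - 2 * s * b) * v - (b ^ 2 + a₂ ^ 2) * v ^ 2)| +
      |2 * √(1 - v) * v * (c * a₂ + s * b₂ + v * (a * a₂ + b * b₂))| ≤ ε := by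
  have hq : √(1 - v) ^ 2 = 1 - v := Real.sq_sqrt (by linarith [hv.2])
  have hq0 : 0 ≤ √(1 - v) := Real.sqrt_nonneg _
  set q := √(1 - v)
  have hq1 : q ≤ 1 := by nlinarith [hv.1]
  have hv' : v = 1 - q ^ 2 := by linarith
  -- The errors at `±q` are even part plus or minus odd part, and `|e| + |o| = max |e ± o|`.
  have h1 := abs_le.1 (hE q ⟨by linarith, hq1⟩)
  have h2 := abs_le.1 (hE (-q) ⟨by linarith, by linarith⟩)
  have k1 : cubicError c s a a₂ b b₂ q =
      v * ((2 * a * c + 2 * s * b - s ^ 2)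
      + (a ^ 2 + b₂ ^ 2 + a₂ ^ 2 + b ^ 2 - 2 * s * b) * v - (b ^ 2 + a₂ ^ 2) * v ^ 2) +
      2 * q * v * (c * a₂ + s * b₂ + v * (a * a₂ + b * b₂)) := by
    unfold cubicError
    rw [hv']
    linear_combination hcs
  have k2 : cubicError c s a a₂ b b₂ (-q) =
      v * ((2 * a * c + 2 * s * b - s ^ 2)
      + (a ^ 2 + b₂ ^ 2 + a₂ ^ 2 + b ^ 2 - 2 * s * b) * v - (b ^ 2 + a₂ ^ 2) * v ^ 2) -
      2 * q * v * (c * a₂ + s * b₂ + v * (a * a₂ + b * b₂)) := by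
    unfold cubicError
    rw [hv']
    linear_combination hcs
  rw [k1] at h1
  rw [k2] at h2
  rcases abs_cases (v * ((2 * a * c + 2 * s * b - s ^ 2)
      + (a ^ 2 + b₂ ^ 2 + a₂ ^ 2 + b ^ 2 - 2 * s * b) * v - (b ^ 2 + a₂ ^ 2) * v ^ 2))
    with ⟨h, _⟩ | ⟨h, _⟩ <;>
  rcases abs_cases (2 * q * v * (c * a₂ + s * b₂ + v * (a * a₂ + b * b₂)))
    with ⟨h', _⟩ | ⟨h', _⟩ <;>
  rw [h, h'] <;> linarith [h1.1, h1.2, h2.1, h2.2]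

/-- The nodes satisfy `0 < 3√3 - 5 < √3 - 1 < 1`. The divided differences of the quadratic have
alternating signs, and positivity of the nodes passes these signs on to the coefficients. -/
theorem signs_of_alternating {A B D : ℝ} (s1 : 0 ≤ A + B + D)
    (s2 : A + B * (√3 - 1) + D * (√3 - 1) ^ 2 ≤ 0)
    (s3 : 0 ≤ A + B * (3 * √3 - 5) + D * (3 * √3 - 5) ^ 2) : 0 ≤ A ∧ B ≤ 0 ∧ 0 ≤ D := by
  have hr := sqrt_three_sq
  obtain ⟨hr1, hr2⟩ := sqrt_three_bounds
  -- slopes of the chords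
  have c1 : 0 ≤ B + D * √3 := by
    have : 0 ≤ (2 - √3) * (B + D * √3) := by linarith
    exact nonneg_of_mul_nonneg_right this (by linarith)
  have c2 : B + D * (4 * √3 - 6) ≤ 0 := by
    have : (4 - 2 * √3) * (B + D * (4 * √3 - 6)) ≤ 0 := by linarith
    by_contra! hlt
    have := mul_pos (show 0 < 4 - 2 * √3 by linarith) hlt
    linarith
  have hD0 : 0 ≤ D := by
    have : 0 ≤ (6 - 3 * √3) * D := by linarith
    exact nonneg_of_mul_nonneg_right this (by linarith)
  have hB0 : B ≤ 0 := by
    have := mul_nonneg hD0 (show 0 ≤ 4 * √3 - 6 by linarith)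
    linarith
  have hA0 : 0 ≤ A := by
    have h1 := mul_nonneg_of_nonpos_of_nonpos c2 (show -(3 * √3 - 5) ≤ 0 by linarith)
    have h2 := mul_nonneg hD0 (mul_nonneg (show 0 ≤ 3 * √3 - 5 by linarith)
      (show 0 ≤ √3 - 1 by linarith))
    linarith
  exact ⟨hA0, hB0, hD0⟩

namespace IsEquioscillating

variable {c s a b ε : ℝ}

theorem eps_pos (h : IsEquioscillating c s a b ε) : 0 < ε := by
  have h3 := h.coeff_two
  have hb : 0 < b ^ 2 := pow_pos h.b_pos 2
  rw [h3] at hb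
  exact pos_of_mul_pos_right hb (by positivity)

/-- The right side is `ε T₃(w)`. At `v = 0` the argument `√3/2` is a zero of `T₃`, as interpolation
demands; at `v = 1` it is `-1`. -/
theorem cubicError_eq (h : IsEquioscillating c s a b ε) (t : ℝ) :
    cubicError c s a 0 b 0 t =
      ε * (4 * (√3 / 2 - (1 + √3 / 2) * (1 - t ^ 2)) ^ 3
        - 3 * (√3 / 2 - (1 + √3 / 2) * (1 - t ^ 2))) := by
  have hr := sqrt_three_sq
  unfold cubicError
  linear_combination h.sq_add_sq + (1 - t ^ 2) * h.coeff_zero + (1 - t ^ 2) ^ 2 * h.coeff_one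
    - (1 - t ^ 2) ^ 3 * h.coeff_two
    - ε * (√3 / 2 - 3 * (1 + √3 / 2) * (1 - t ^ 2)) * hr

theorem abs_cubicError_le (h : IsEquioscillating c s a b ε) {t : ℝ} (ht : t ∈ Set.Icc (-1 : ℝ) 1) :
    |cubicError c s a 0 b 0 t| ≤ ε := by
  rw [h.cubicError_eq]
  have hr := sqrt_three_sq
  have hr2 := sqrt_three_bounds
  have hv0 : 0 ≤ 1 - t ^ 2 := by nlinarith [ht.1, ht.2]
  have hv1 : 0 ≤ t ^ 2 := sq_nonneg t
  set w := √3 / 2 - (1 + √3 / 2) * (1 - t ^ 2) with hw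
  have hw0 : 0 ≤ w + 1 := by rw [hw]; nlinarith
  have hw1 : 0 ≤ 1 - w := by rw [hw]; nlinarith
  -- `1 + T₃(w) = (1 + w)(2w - 1)²` and `1 - T₃(w) = (1 - w)(2w + 1)²`.
  have hT : |4 * w ^ 3 - 3 * w| ≤ 1 := by
    rw [abs_le]
    constructor
    · nlinarith [mul_nonneg hw0 (sq_nonneg (2 * w - 1))]
    · nlinarith [mul_nonneg hw1 (sq_nonneg (2 * w + 1))]
  rw [abs_mul, abs_of_pos h.eps_pos]
  exact mul_le_of_le_one_right h.eps_pos.le hT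

/-- A cubic interpolant whose error is nowhere larger than that of the equioscillating one is
equal to it or, on the half circle, to its reflection. -/
theorem eq_of_abs_cubicError_le (h : IsEquioscillating c s a b ε) {a' a₂ b' b₂ : ℝ}
    (hE : ∀ t ∈ Set.Icc (-1 : ℝ) 1, |cubicError c s a' a₂ b' b₂ t| ≤ ε) :
    a₂ = 0 ∧ b₂ = 0 ∧ b' = b ∧ (a' = a ∨ c = 0 ∧ a' = -a) := by
  have hr := sqrt_three_sq
  obtain ⟨hr1, hr2⟩ := sqrt_three_bounds
  obtain ⟨hc, hs, hcs, ha, hb, hbs, e0, e1, e2⟩ := id h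
  have hev := fun v hv => abs_even_add_abs_odd_le hcs hE (v := v) hv
  obtain ⟨A, hA⟩ : ∃ A, A = 2 * (c * (a' - a) + s * (b' - b)) := ⟨_, rfl⟩
  obtain ⟨B, hB⟩ : ∃ B, B = a' ^ 2 - a ^ 2 + b₂ ^ 2 + a₂ ^ 2 + b' ^ 2 - b ^ 2
    - 2 * s * (b' - b) := ⟨_, rfl⟩
  obtain ⟨D, hD⟩ : ∃ D, D = b ^ 2 - b' ^ 2 - a₂ ^ 2 := ⟨_, rfl⟩
  have hcmp : ∀ v, v * ((2 * a' * c + 2 * s * b' - s ^ 2)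
        + (a' ^ 2 + b₂ ^ 2 + a₂ ^ 2 + b' ^ 2 - 2 * s * b') * v - (b' ^ 2 + a₂ ^ 2) * v ^ 2) =
      v * (A + B * v + D * v ^ 2) + ε * (4 * (√3 / 2 - (1 + √3 / 2) * v) ^ 3
        - 3 * (√3 / 2 - (1 + √3 / 2) * v)) := by
    intro v
    rw [hA, hB, hD]
    linear_combination v * e0 + v ^ 2 * e1 - v ^ 3 * e2
      - ε * (√3 / 2 - 3 * (1 + √3 / 2) * v) * hr
  have s1 : 0 ≤ A + B + D := by
    have := (abs_le.1 ((le_add_of_nonneg_right (abs_nonneg _)).trans (hev 1 ⟨by norm_num, le_rfl⟩))).1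
    rw [hcmp] at this
    linarith
  have hv1 : (√3 - 1) ∈ Set.Icc (0 : ℝ) 1 := ⟨by linarith, by linarith⟩
  have hv2 : (3 * √3 - 5) ∈ Set.Icc (0 : ℝ) 1 := ⟨by linarith, by linarith⟩
  have w1 : √3 / 2 - (1 + √3 / 2) * (√3 - 1) = -(1 / 2) := by linear_combination -(1 / 2) * hr
  have w2 : √3 / 2 - (1 + √3 / 2) * (3 * √3 - 5) = 1 / 2 := by linear_combination -(3 / 2) * hr
  have s2 : A + B * (√3 - 1) + D * (√3 - 1) ^ 2 ≤ 0 := by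
    have := (abs_le.1 ((le_add_of_nonneg_right (abs_nonneg _)).trans (hev _ hv1))).2
    rw [hcmp, w1] at this
    by_contra! hlt
    have := mul_pos (show 0 < √3 - 1 by linarith) hlt
    linarith
  have s3 : 0 ≤ A + B * (3 * √3 - 5) + D * (3 * √3 - 5) ^ 2 := by
    have := (abs_le.1 ((le_add_of_nonneg_right (abs_nonneg _)).trans (hev _ hv2))).1
    rw [hcmp, w2] at this
    by_contra! hlt
    have := mul_neg_of_pos_of_neg (show 0 < 3 * √3 - 5 by linarith) hlt
    linarith
  obtain ⟨hA0, hB0, hD0⟩ := signs_of_alternating s1 s2 s3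
  have hb' : b' ≤ b := by
    have : b' ^ 2 ≤ b ^ 2 := by nlinarith [sq_nonneg a₂]
    exact (abs_le_of_sq_le_sq' this hb.le).2
  have hfac : 0 ≤ (b - b') * (2 * s - b - b') := mul_nonneg (by linarith) (by linarith)
  have hsb : 0 ≤ s * (b - b') := mul_nonneg hs.le (by linarith)
  -- For `c = 0` the inequality `A ≥ 0` says nothing about `a'`, but it gives `b' = b` directly.
  rcases hc.eq_or_lt with hc0 | hc0
  · have hbb : b' = b := by
      have : s * (b - b') ≤ 0 := by rw [hA, ← hc0] at hA0; linarith
      by_contra hne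
      have := mul_pos hs (sub_pos.2 (lt_of_le_of_ne hb' hne))
      linarith
    subst hbb
    have ha2 : a₂ = 0 := by
      have : a₂ ^ 2 ≤ 0 := by linarith
      simpa using le_antisymm this (sq_nonneg a₂)
    subst ha2
    have hAz : A = 0 := by rw [hA, ← hc0]; ring
    have hDz : D = 0 := by rw [hD]; ring
    have hBz : B = 0 := by rw [hAz, hDz] at s1; linarith
    -- At `v = √3 - 1` the even part already equals `ε`, so the odd part must vanish there; it is a
    -- positive multiple of `b₂`.
    have hb2 : b₂ = 0 := by
      have := hev _ hv1
      rw [hcmp, w1, hAz, hBz, hDz, ← hc0] at this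
      have hz : |2 * √(1 - (√3 - 1)) * (√3 - 1) * (s + (√3 - 1) * b')| * |b₂| ≤ 0 := by
        rw [← abs_mul]
        have e : ε * (4 * (-(1 / 2) : ℝ) ^ 3 - 3 * -(1 / 2)) = ε := by ring
        rw [e, show (√3 - 1) * (0 + 0 * (√3 - 1) + 0 * (√3 - 1) ^ 2) + ε = ε by ring,
          abs_of_pos h.eps_pos] at this
        have e2 : 2 * √(1 - (√3 - 1)) * (√3 - 1) * (s + (√3 - 1) * b') * b₂ =
          2 * √(1 - (√3 - 1)) * (√3 - 1) * (0 * 0 + s * b₂ + (√3 - 1) * (a' * 0 + b' * b₂)) := by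
          ring
        rw [e2]
        linarith
      have hp : 0 < 2 * √(1 - (√3 - 1)) * (√3 - 1) * (s + (√3 - 1) * b') := by
        have h1 : 0 < √(1 - (√3 - 1)) := Real.sqrt_pos.2 (by linarith)
        have h2 : 0 < √3 - 1 := by linarith
        positivity
      rw [abs_of_pos hp] at hz
      by_contra hne
      exact absurd (mul_pos hp (abs_pos.2 hne)) (not_lt.2 hz)
    subst hb2
    refine ⟨rfl, rfl, rfl, ?_⟩
    have : a' ^ 2 = a ^ 2 := by rw [hB] at hBz; linarith
    rcases sq_eq_sq_iff_eq_or_eq_neg.1 this with h | h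
    · exact Or.inl h
    · exact Or.inr ⟨hc0.symm, h⟩
  · have haa : a ≤ a' := by
      have : 0 ≤ c * (a' - a) := by linarith
      linarith [nonneg_of_mul_nonneg_right this hc0]
    have hpa : 0 ≤ (a' - a) * (a' + a) := mul_nonneg (by linarith) (by linarith)
    have n1 := sq_nonneg a₂
    have n2 := sq_nonneg b₂
    -- This is `B ≤ 0`, rewritten as a sum of nonnegative terms; `b < s` makes the last factor
    -- positive.
    have hsum : (a' - a) * (a' + a) + b₂ ^ 2 + a₂ ^ 2 + (b - b') * (2 * s - b - b') ≤ 0 := by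
      rw [hB] at hB0; linarith
    have z1 : a₂ ^ 2 = 0 := by linarith
    have z2 : b₂ ^ 2 = 0 := by linarith
    have z3 : (a' - a) * (a' + a) = 0 := by linarith
    have z4 : (b - b') * (2 * s - b - b') = 0 := by linarith
    refine ⟨by simpa using z1, by simpa using z2, ?_, Or.inl ?_⟩
    · rcases mul_eq_zero.1 z4 with h | h <;> linarith
    · rcases mul_eq_zero.1 z3 with h | h <;> linarith

end IsEquioscillating

/-! ### Solving the equations of equioscillation -/

/-- The cubic polynomial of the theorem as a function of `c` and `a = 3 (x - c) / 4`. -/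
theorem cubicF_eq (φ a : ℝ) :
    a * (1 + √3 / 2) ^ 2 * cubicF φ (Real.cos φ + 4 * a / 3) =
      16 * (((1 - Real.cos φ ^ 2) - 2 * a * Real.cos φ
        - 6 * (1 + √3 / 2) * (1 - (Real.cos φ + a) ^ 2)) ^ 2
        - 16 * (1 + √3 / 2) ^ 3 * (1 - Real.cos φ ^ 2) * (1 - (Real.cos φ + a) ^ 2)) := by
  have hr := sqrt_three_sq
  have h3 : √3 ^ 3 = 3 * √3 := by rw [pow_succ, hr]
  unfold cubicF
  generalize Real.cos φ = c
  ring_nf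
  simp only [hr, h3]
  ring

/-- The resultant of the equations of equioscillation has at most one positive zero. -/
theorem equioscillation_root_unique {c l a a' : ℝ} (hc : 0 ≤ c) (hc1 : c < 1) (hl : 1 < l)
    (hl2 : (6 * l - 1) ^ 2 = 16 * l ^ 3) (ha : 0 < a) (ha' : 0 < a')
    (h : ((1 - c ^ 2) - 2 * a * c - 6 * l * (1 - (c + a) ^ 2)) ^ 2
      = 16 * l ^ 3 * (1 - c ^ 2) * (1 - (c + a) ^ 2))
    (h' : ((1 - c ^ 2) - 2 * a' * c - 6 * l * (1 - (c + a') ^ 2)) ^ 2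
      = 16 * l ^ 3 * (1 - c ^ 2) * (1 - (c + a') ^ 2)) : a = a' := by
  obtain ⟨g0, hg0⟩ : ∃ g, g = -2 * c * (1 - c ^ 2) * (6 * l - 1) ^ 2 := ⟨_, rfl⟩
  obtain ⟨g1, hg1⟩ : ∃ g, g = (6 * l - 1) * (4 * c ^ 2 * (6 * l - 1) - (1 - c ^ 2) * (6 * l + 1)) :=
    ⟨_, rfl⟩
  obtain ⟨g2, hg2⟩ : ∃ g, g = 24 * l * c * (6 * l - 1) := ⟨_, rfl⟩
  obtain ⟨g3, hg3⟩ : ∃ g, g = 36 * l ^ 2 := ⟨_, rfl⟩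
  have key : ∀ x, 0 < x → ((1 - c ^ 2) - 2 * x * c - 6 * l * (1 - (c + x) ^ 2)) ^ 2
      = 16 * l ^ 3 * (1 - c ^ 2) * (1 - (c + x) ^ 2) →
      g3 * x ^ 3 + g2 * x ^ 2 + g1 * x + g0 = 0 := by
    intro x hx hq
    have : x * (g3 * x ^ 3 + g2 * x ^ 2 + g1 * x + g0) = 0 := by
      rw [hg0, hg1, hg2, hg3]
      -- By `hl2` the quartic has the spurious root `x = 0`, which is divided out.
      linear_combination hq - (1 - c ^ 2) * (1 - (c + x) ^ 2) * hl2
    exact (mul_eq_zero.1 this).resolve_left hx.ne'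
  have k := key a ha h
  have k' := key a' ha' h'
  have h3 : 0 < g3 := by rw [hg3]; positivity
  have hl6 : 0 ≤ 6 * l - 1 := by linarith
  have h2 : 0 ≤ g2 := by rw [hg2]; positivity
  have h0 : 0 ≤ -g0 := by
    have : 0 ≤ 1 - c ^ 2 := by nlinarith
    rw [hg0, show -(-2 * c * (1 - c ^ 2) * (6 * l - 1) ^ 2) = 2 * c * (1 - c ^ 2) * (6 * l - 1) ^ 2
      by ring]
    positivity
  -- Eliminating `g1`, the only coefficient of undetermined sign, gives a quantitative form of
  -- Descartes' rule.
  have hfac : (a' - a) * (g3 * (a * a' * (a + a')) + g2 * (a * a') + -g0) = 0 := by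
    linear_combination a * k' - a' * k
  have hpos : 0 < g3 * (a * a' * (a + a')) + g2 * (a * a') + -g0 := by positivity
  linarith [(mul_eq_zero.1 hfac).resolve_right hpos.ne']

/-- The expression `P` stands for `2 s b`, so the root must lie where `P > 0`. It is found between
the zero `a₀` of `P`, where the difference of the two sides is negative, and `1 - c`, where the
right side vanishes. -/
theorem exists_equioscillation_root {c l : ℝ} (hc : 0 ≤ c) (hc1 : c < 1) (hl : 1 < l) :
    ∃ a, 0 < a ∧ a < 1 - c ∧
      ((1 - c ^ 2) - 2 * a * c - 6 * l * (1 - (c + a) ^ 2)) ^ 2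
        = 16 * l ^ 3 * (1 - c ^ 2) * (1 - (c + a) ^ 2) ∧
      0 < (1 - c ^ 2) - 2 * a * c - 6 * l * (1 - (c + a) ^ 2) ∧
      (1 - c ^ 2) - 2 * a * c - 6 * l * (1 - (c + a) ^ 2) < (1 - c) ^ 2 := by
  obtain ⟨P, hP⟩ : ∃ P : ℝ → ℝ, P = fun a => (1 - c ^ 2) - 2 * a * c - 6 * l * (1 - (c + a) ^ 2) :=
    ⟨_, rfl⟩
  have hPc : Continuous P := by rw [hP]; fun_prop
  have hc2 : 0 < 1 - c ^ 2 := by nlinarith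
  have hP0 : P 0 < 0 := by
    have h0 : P 0 = -((1 - c ^ 2) * (6 * l - 1)) := by rw [hP]; ring
    have := mul_pos hc2 (show 0 < 6 * l - 1 by linarith)
    linarith
  have hP1 : P (1 - c) = (1 - c) ^ 2 := by rw [hP]; ring
  have hP1' : 0 < P (1 - c) := by rw [hP1]; exact pow_pos (by linarith) 2
  have hmono : ∀ x y, 0 ≤ x → x < y → P x < P y := by
    intro x y hx hxy
    have h1 : 0 < (y - x) * (2 * c * (6 * l - 1) + 6 * l * (x + y)) := by
      have : 0 < y - x := by linarith
      have : 0 < x + y := by linarith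
      have : 0 ≤ 6 * l - 1 := by linarith
      have : 0 < l := by linarith
      positivity
    have h2 : P y - P x = (y - x) * (2 * c * (6 * l - 1) + 6 * l * (x + y)) := by rw [hP]; ring
    linarith
  obtain ⟨a₀, ⟨h00, h01⟩, ha₀⟩ := intermediate_value_Ioo (show (0 : ℝ) ≤ 1 - c by linarith)
    hPc.continuousOn ⟨hP0, hP1'⟩
  obtain ⟨Q, hQ⟩ : ∃ Q : ℝ → ℝ,
    Q = fun a => P a ^ 2 - 16 * l ^ 3 * (1 - c ^ 2) * (1 - (c + a) ^ 2) := ⟨_, rfl⟩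
  have hQc : Continuous Q := by rw [hQ]; fun_prop
  have hQ0 : Q a₀ < 0 := by
    have h1 : 0 < 1 - (c + a₀) ^ 2 := by nlinarith
    have h2 : 0 < 16 * l ^ 3 * (1 - c ^ 2) * (1 - (c + a₀) ^ 2) := by positivity
    rw [hQ]
    simp only [ha₀]
    linarith
  have hQ1 : 0 < Q (1 - c) := by
    have h2 := pow_pos hP1' 2
    rw [hQ]
    simp only [add_sub_cancel]
    linarith
  obtain ⟨a, ⟨h1, h2⟩, ha⟩ := intermediate_value_Ioo h01.le hQc.continuousOn ⟨hQ0, hQ1⟩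
  have m1 := hmono _ _ h00.le h1
  have m2 := hmono _ _ (h00.trans h1).le h2
  rw [ha₀] at m1
  rw [hP1] at m2
  rw [hQ] at ha
  simp only at ha
  rw [hP] at m1 m2 ha
  exact ⟨a, h00.trans h1, h2, by linarith, m1, m2⟩

/-- The value at `t = 0` gives `ε = 1 - (c + a)²`; then `coeff_zero` gives `2 s b = P`, and
`coeff_two` becomes the equation for `a`. -/
theorem cubicF_root (φ : ℝ) (hc : 0 ≤ Real.cos φ) (hs : 0 < Real.sin φ) :
    ∃ ξ, (ξ ∈ Set.Ioo (Real.cos φ) ((4 + Real.cos φ) / 3) ∧ cubicF φ ξ = 0 ∧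
        ∀ x ∈ Set.Ioo (Real.cos φ) ((4 + Real.cos φ) / 3), cubicF φ x = 0 → x = ξ) ∧
      IsEquioscillating (Real.cos φ) (Real.sin φ) (3 * (ξ - Real.cos φ) / 4)
        ((3 * cubicEta φ ξ - Real.sin φ) / 4) (1 - (Real.cos φ + 3 * (ξ - Real.cos φ) / 4) ^ 2) := by
  have hr := sqrt_three_sq
  have hr2 := sqrt_three_bounds
  have hcs := Real.cos_sq_add_sin_sq φ
  have hc1 : Real.cos φ < 1 := by nlinarith
  obtain ⟨l, hl⟩ : ∃ l, l = 1 + √3 / 2 := ⟨_, rfl⟩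
  have hl1 : 1 < l := by rw [hl]; linarith
  have hl2 : (6 * l - 1) ^ 2 = 16 * l ^ 3 := by
    rw [hl]; linear_combination (-3 - 2 * √3) * hr
  have hF := cubicF_eq φ
  have heta : ∀ a, (3 * cubicEta φ (Real.cos φ + 4 * a / 3) - Real.sin φ) / 4 =
      ((1 - Real.cos φ ^ 2) - 2 * a * Real.cos φ - 6 * l * (1 - (Real.cos φ + a) ^ 2))
        / (2 * Real.sin φ) := by
    intro a
    rw [hl]
    unfold cubicEta
    field_simp
    linear_combination -32 * hcs
  rw [← hl] at hF
  generalize hcc : Real.cos φ = c at *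
  generalize hss : Real.sin φ = s at *
  obtain ⟨a, ha0, ha1, hQ, hP0, hP1⟩ := exists_equioscillation_root hc hc1 hl1
  have hxa : 3 * (c + 4 * a / 3 - c) / 4 = a := by ring
  refine ⟨c + 4 * a / 3, ⟨⟨by linarith, by linarith⟩, ?_, ?_⟩, ?_⟩
  · have h1 := hF a
    rw [hQ, sub_self, mul_zero] at h1
    exact (mul_eq_zero.1 h1).resolve_left (by positivity)
  · intro x hx h0
    have h1 := hF (3 * (x - c) / 4)
    rw [show c + 4 * (3 * (x - c) / 4) / 3 = x by ring, h0, mul_zero] at h1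
    have := equioscillation_root_unique hc hc1 hl1 hl2 (by linarith [hx.1]) ha0
      (show _ from (by linarith : _ = _)) hQ (a := 3 * (x - c) / 4)
    linarith
  · rw [hxa, heta]
    generalize hPP : (1 - c ^ 2) - 2 * a * c - 6 * l * (1 - (c + a) ^ 2) = P at *
    have hs2 : 1 - c ^ 2 = s ^ 2 := by linarith
    have hb : 2 * s * (P / (2 * s)) = P := by field_simp
    have hb2 : (P / (2 * s)) ^ 2 = 4 * l ^ 3 * (1 - (c + a) ^ 2) := by
      rw [div_pow, hQ, hs2]
      field_simp
      ring
    refine ⟨hc, hs, hcs, ha0, by positivity, ?_, ?_, ?_, ?_⟩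
    · rw [div_lt_iff₀ (by positivity)]
      nlinarith
    · rw [hb, ← hl]
      linarith
    · rw [hb, hb2, ← hl]
      -- This is `T₃(√3/2 - l) = T₃(-1) = -1`; it makes `coeff_one` follow from the other two
      -- equations.
      have : 4 * l ^ 3 = 6 * √3 * l ^ 2 - 6 * l + 1 := by
        rw [hl]; linear_combination (-3 - √3) * hr
      linear_combination (1 - (c + a) ^ 2) * this + hPP
    · rw [hb2, ← hl]

/-! ### From polynomial curves to the parameters -/

theorem signedError_eq (p : PolyCurve) (c s a a₂ b b₂ : ℝ)
    (h1 : ∀ t, p.1.eval t = c + (1 - t ^ 2) * (a + a₂ * t))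
    (h2 : ∀ t, p.2.eval t = s * t + (1 - t ^ 2) * (b * t + b₂)) (t : ℝ) :
    signedError p t = cubicError c s a a₂ b b₂ t := by
  rw [signedError, cubicError, h1, h2]

theorem eval_of_natDegree_le_three {p : ℝ[X]} (hp : p.natDegree ≤ 3) (t : ℝ) :
    p.eval t = p.coeff 0 + p.coeff 1 * t + p.coeff 2 * t ^ 2 + p.coeff 3 * t ^ 3 := by
  rw [eval_eq_sum_range' (Nat.lt_succ_of_le hp)]
  simp [Finset.sum_range_succ]

theorem IsG0Interpolant.exists_eval_eq {φ : ℝ} {p : PolyCurve} (hp : IsG0Interpolant φ 3 p) :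
    ∃ a a₂ b b₂ : ℝ, (∀ t, p.1.eval t = Real.cos φ + (1 - t ^ 2) * (a + a₂ * t)) ∧
      ∀ t, p.2.eval t = Real.sin φ * t + (1 - t ^ 2) * (b * t + b₂) := by
  obtain ⟨d1, d2, x0, y0, x1, y1⟩ := hp
  rw [eval_of_natDegree_le_three d1] at x0 x1
  rw [eval_of_natDegree_le_three d2] at y0 y1
  refine ⟨-p.1.coeff 2, -p.1.coeff 3, -p.2.coeff 3, -p.2.coeff 2, fun t => ?_, fun t => ?_⟩
  · rw [eval_of_natDegree_le_three d1]
    linear_combination (x0 + x1) / 2 + t * (x1 - x0) / 2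
  · rw [eval_of_natDegree_le_three d2]
    linear_combination (y0 + y1) / 2 + t * (y1 - y0) / 2

theorem natDegree_bernsteinSym_le {n j : ℕ} (hj : j ≤ n) : (bernsteinSym n j).natDegree ≤ n := by
  have h1 : (C (1 / 2 : ℝ) * (1 + X)).natDegree ≤ 1 := by compute_degree
  have h2 : (C (1 / 2 : ℝ) * (1 - X)).natDegree ≤ 1 := by compute_degree
  have h3 := natDegree_pow_le_of_le j h1
  have h4 := natDegree_pow_le_of_le (n - j) h2
  have := natDegree_mul_le_of_le (natDegree_mul_le_of_le (natDegree_C (n.choose j : ℝ)).le h3) h4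
  unfold bernsteinSym
  exact this.trans (by omega)

theorem natDegree_bezierCurve_le {n : ℕ} (b : Fin (n + 1) → ℝ × ℝ) :
    (bezierCurve b).1.natDegree ≤ n ∧ (bezierCurve b).2.natDegree ≤ n := by
  have key : ∀ f : Fin (n + 1) → ℝ, (∑ j, C (f j) * bernsteinSym n j).natDegree ≤ n := fun f =>
    natDegree_sum_le_of_forall_le Finset.univ (fun j => C (f j) * bernsteinSym n j) fun j _ =>
      (natDegree_C_mul_le _ _).trans (natDegree_bernsteinSym_le (Nat.le_of_lt_succ j.2))
  exact ⟨key fun j => (b j).1, key fun j => (b j).2⟩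

theorem symmetricCubic_eval_fst (φ ξ η t : ℝ) : (symmetricCubic φ ξ η).1.eval t =
    Real.cos φ + (1 - t ^ 2) * (3 * (ξ - Real.cos φ) / 4 + 0 * t) := by
  simp [symmetricCubic, bezierCurve, bernsteinSym, Fin.sum_univ_four, Nat.choose]
  ring

theorem symmetricCubic_eval_snd (φ ξ η t : ℝ) : (symmetricCubic φ ξ η).2.eval t =
    Real.sin φ * t + (1 - t ^ 2) * ((3 * η - Real.sin φ) / 4 * t + 0) := by
  simp [symmetricCubic, bezierCurve, bernsteinSym, Fin.sum_univ_four, Nat.choose]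
  ring

theorem signedError_symmetricCubic (φ ξ η t : ℝ) : signedError (symmetricCubic φ ξ η) t =
    cubicError (Real.cos φ) (Real.sin φ) (3 * (ξ - Real.cos φ) / 4) 0
      ((3 * η - Real.sin φ) / 4) 0 t :=
  signedError_eq _ _ _ _ _ _ _ (symmetricCubic_eval_fst φ ξ η) (symmetricCubic_eval_snd φ ξ η) t

theorem isG0Interpolant_symmetricCubic (φ ξ η : ℝ) :
    IsG0Interpolant φ 3 (symmetricCubic φ ξ η) := by
  refine ⟨(natDegree_bezierCurve_le _).1, (natDegree_bezierCurve_le _).2, ?_, ?_, ?_, ?_⟩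
  all_goals simp only [symmetricCubic_eval_fst, symmetricCubic_eval_snd]; ring

theorem abs_signedError_le (p : PolyCurve) {t : ℝ} (ht : t ∈ Set.Icc (-1 : ℝ) 1) :
    |signedError p t| ≤ simplifiedRadialError p := by
  refine le_csSup ?_ ⟨t, ht, rfl⟩
  refine (isCompact_Icc.image_of_continuousOn (Continuous.continuousOn ?_)).bddAbove
  unfold signedError
  fun_prop

theorem simplifiedRadialError_le {p : PolyCurve} {ε : ℝ}
    (h : ∀ t ∈ Set.Icc (-1 : ℝ) 1, |signedError p t| ≤ ε) : simplifiedRadialError p ≤ ε := by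
  refine csSup_le (Set.Nonempty.image _ ⟨0, by simp⟩) ?_
  rintro _ ⟨t, ht, rfl⟩
  exact h t ht

theorem cos_eq_zero_iff_eq_pi_div_two {φ : ℝ} (hφ0 : 0 < φ) (hφ1 : φ ≤ Real.pi / 2) :
    Real.cos φ = 0 ↔ φ = Real.pi / 2 := by
  refine ⟨fun h => ?_, fun h => h ▸ Real.cos_pi_div_two⟩
  by_contra hne
  exact (Real.cos_pos_of_mem_Ioo ⟨by linarith, lt_of_le_of_ne hφ1 hne⟩).ne' h

/-! ### The main theorem -/

theorem mainTheorem2 (φ : ℝ) (hφ0 : 0 < φ) (hφ1 : φ ≤ Real.pi / 2) :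
    ∃ ξ η : ℝ,
      -- `ξ` is the only zero of the explicit cubic in the open interval, `η` is given by the formula
      (ξ ∈ Set.Ioo (Real.cos φ) ((4 + Real.cos φ) / 3) ∧ cubicF φ ξ = 0 ∧
        ∀ x ∈ Set.Ioo (Real.cos φ) ((4 + Real.cos φ) / 3), cubicF φ x = 0 → x = ξ) ∧
      η = cubicEta φ ξ ∧
      -- `(ξ, η)` is the unique pair of parameters giving the best symmetric cubic interpolant
      (∀ ξ' η' : ℝ, (φ = Real.pi / 2 → 0 ≤ ξ') → (ξ', η') ≠ (ξ, η) →
        simplifiedRadialError (symmetricCubic φ ξ η) <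
          simplifiedRadialError (symmetricCubic φ ξ' η')) ∧
      -- it is the best among all cubic interpolants, symmetric or not, and the only best one
      -- (up to the reflection over the `y`-axis if the arc is a half circle)
      (∀ p : PolyCurve, IsBestG0Interpolant φ 3 p ↔
        (p = symmetricCubic φ ξ η ∨ (φ = Real.pi / 2 ∧ p = symmetricCubic φ (-ξ) η))) := by
  have hc : 0 ≤ Real.cos φ := Real.cos_nonneg_of_mem_Icc ⟨by linarith, hφ1⟩
  have hs : 0 < Real.sin φ := Real.sin_pos_of_pos_of_lt_pi hφ0 (by linarith [Real.pi_pos])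
  have hiff := cos_eq_zero_iff_eq_pi_div_two hφ0 hφ1
  obtain ⟨ξ, hξ, hosc⟩ := cubicF_root φ hc hs
  obtain ⟨η, hη⟩ : ∃ η, η = cubicEta φ ξ := ⟨_, rfl⟩
  rw [← hη] at hosc
  have hle : simplifiedRadialError (symmetricCubic φ ξ η) ≤ _ := simplifiedRadialError_le
    fun t ht => by rw [signedError_symmetricCubic]; exact hosc.abs_cubicError_le ht
  have hbest : ∀ p, IsG0Interpolant φ 3 p →
      simplifiedRadialError p ≤ simplifiedRadialError (symmetricCubic φ ξ η) →
      p = symmetricCubic φ ξ η ∨ (φ = Real.pi / 2 ∧ p = symmetricCubic φ (-ξ) η) := by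
    intro p hp hpe
    obtain ⟨a, a₂, b, b₂, h1, h2⟩ := hp.exists_eval_eq
    obtain ⟨rfl, rfl, rfl, h | ⟨h, h'⟩⟩ := hosc.eq_of_abs_cubicError_le fun t ht => by
      rw [← signedError_eq p _ _ a a₂ b b₂ h1 h2]
      exact (abs_signedError_le p ht).trans (hpe.trans hle)
    · refine Or.inl (Prod.ext (Polynomial.funext fun t => ?_) (Polynomial.funext fun t => ?_))
      · rw [h1, h, symmetricCubic_eval_fst]
      · rw [h2, symmetricCubic_eval_snd]
    · refine Or.inr ⟨hiff.1 h, Prod.ext (Polynomial.funext fun t => ?_)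
        (Polynomial.funext fun t => ?_)⟩
      · rw [h1, h', symmetricCubic_eval_fst, h]; ring
      · rw [h2, symmetricCubic_eval_snd]
  have hrefl : φ = Real.pi / 2 → simplifiedRadialError (symmetricCubic φ (-ξ) η) =
      simplifiedRadialError (symmetricCubic φ ξ η) := by
    intro h
    have : signedError (symmetricCubic φ (-ξ) η) = signedError (symmetricCubic φ ξ η) := by
      funext t
      simp only [signedError_symmetricCubic, cubicError, hiff.2 h]
      ring
    unfold simplifiedRadialError
    rw [this]
  have hmin : ∀ q, IsG0Interpolant φ 3 q →
      simplifiedRadialError (symmetricCubic φ ξ η) ≤ simplifiedRadialError q := by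
    intro q hq
    -- A strictly better `q` would be one of the two curves in `hbest`, whose errors are equal.
    by_contra! hlt
    rcases hbest q hq hlt.le with rfl | ⟨h, rfl⟩
    · exact lt_irrefl _ hlt
    · exact hlt.ne (hrefl h)
  refine ⟨ξ, η, hξ, hη, fun ξ' η' hnn hne => ?_, fun p => ⟨fun hp => ?_, ?_⟩⟩
  · by_contra! hge
    obtain ⟨-, -, hb, ha⟩ := hosc.eq_of_abs_cubicError_le fun t ht => by
      rw [← signedError_symmetricCubic φ ξ' η']
      exact (abs_signedError_le _ ht).trans (hge.trans hle)
    have hη' : η' = η := by linarith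
    rcases ha with ha | ⟨h0, ha⟩
    · exact hne (Prod.ext (by simp only; linarith) hη')
    · have h1 := hnn (hiff.1 h0)
      have h2 := hξ.1.1
      rw [h0] at ha h2
      linarith
  · exact hbest p hp.1 (hp.2 _ (isG0Interpolant_symmetricCubic φ ξ η))
  · rintro (rfl | ⟨h, rfl⟩)
    · exact ⟨isG0Interpolant_symmetricCubic φ ξ η, hmin⟩
    · exact ⟨isG0Interpolant_symmetricCubic φ (-ξ) η, fun q hq => (hrefl h).le.trans (hmin q hq)⟩

end
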